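/- Let $M$ be a smooth $4$-dimensional manifold. For a (smooth) pseudo-Riemannian metric $g_{ab}$ on $M$ with Levi-Civita connection $\nabla$, use the curvature conventions $$\nabla_a\nabla_b\omega_c-\nabla_b\nabla_a\omega_c=R_{abc}{}^d\omega_d,\qquad R_{ac}=R_{abc}{}^b,\qquad R=g^{ac}R_{ac},\qquad L_{ab}=\tfrac12\big(R_{ab}-\tfrac16Rg_{ab}\big),$$ $$C_{abc}{}^d=R_{abc}{}^d-2L^d{}_{[b}g_{a]c}-2\delta^d{}_{[b}L_{a]c},\qquad C\cdot C=C_{abcd}C^{abcd},$$ where indices are moved with $g$. Where $C\cdot C\neq0$ put $$\Lambda_d=\frac{8\,C_d{}^{amp}\,\nabla_{[m}L_{p]a}}{C\cdot C},\qquad D^s_a f=\nabla_a f+s\,\Lambda_a f\qquad(s\in\mathbb Z,\ f\in C^\infty(M)).$$ Let $g_{ab}$ and $\tilde g_{ab}$ be two pseudo-Riemannian metrics on $M$ with $g_{ab}=\Theta^2\tilde g_{ab}$ for a positive function $\Theta\in C^\infty(M)$, and assume that $C\cdot C$ (of $g$) vanishes nowhere on $M$. Let $\tilde\Lambda_a$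 and $\tilde D^s_a f=\tilde\nabla_a f+s\tilde\Lambda_a f$ be the objects built in the same way from $\tilde g$ alone (with indices moved by $\tilde g$). Then for every $s\in\mathbb Z$ the operator $D^s_a$ is conformally covariant on conformally covariant scalars of weight $s$: if $w,\tilde w\in C^\infty(M)$ satisfy $\tilde w=\Theta^s w$, then $$\tilde D^s_a\tilde w=\Theta^s D^s_a w\qquad\text{on }M.$$ -/

import Mathlib

open scoped Manifold ContDiff Bundle

/-- The model space of a four-dimensional manifold. -/
abbrev E4 : Type := EuclideanSpace ℝ (Fin 4)

/-- A smooth pseudo-Riemannian metric on a four-dimensional manifold: a smooth section of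
`T*M ⊗ T*M` that is symmetric and nondegenerate at every point (no restriction on the signature). -/
structure PseudoRiemannianMetric (M : Type*) [TopologicalSpace M] [ChartedSpace E4 M]
    [IsManifold (𝓡 4) ∞ M] where
  /-- The bilinear form on each tangent space. -/
  inner (x : M) : TangentSpace (𝓡 4) x →L[ℝ] TangentSpace (𝓡 4) x →L[ℝ] ℝ
  symm (x : M) (v w : TangentSpace (𝓡 4) x) : inner x v w = inner x w v
  nondegenerate (x : M) (v : TangentSpace (𝓡 4) x) (hv : ∀ w, inner x v w = 0) : v = 0
  contMDiff : ContMDiff (𝓡 4) ((𝓡 4).prod 𝓘(ℝ, E4 →L[ℝ] E4 →L[ℝ] ℝ)) ∞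
    (fun x ↦ Bundle.TotalSpace.mk' (E4 →L[ℝ] E4 →L[ℝ] ℝ) x (inner x))

noncomputable section

/-! Tensor calculus in coordinates. `G i j : E4 → ℝ` are the components `g_{ij}` of a metric, as
functions of the coordinates. Components of all the tensors below are functions of the coordinates
as well, and all index conventions are written next to the definitions. -/
namespace Coord

/-- The partial derivative `∂_a f`. -/
def pd (a : Fin 4) (f : E4 → ℝ) : E4 → ℝ :=
  fun y ↦ fderiv ℝ f y (EuclideanSpace.single a 1)

/-- The Kronecker delta. -/
def delta (a b : Fin 4) : ℝ := if a = b then 1 else 0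

variable (G : Fin 4 → Fin 4 → E4 → ℝ)

/-- The inverse metric `g^{ab}`. -/
def inv (a b : Fin 4) : E4 → ℝ := fun y ↦ (Matrix.of fun i j ↦ G i j y)⁻¹ a b

/-- The Christoffel symbols `Γ^c_{ab} = ½ g^{cd} (∂_a g_{bd} + ∂_b g_{ad} - ∂_d g_{ab})`
of the Levi-Civita connection; the arguments are `c a b`. -/
def christoffel (c a b : Fin 4) : E4 → ℝ := fun y ↦
  (1 / 2) * ∑ d, inv G c d y * (pd a (G b d) y + pd b (G a d) y - pd d (G a b) y)

/-- The Riemann tensor `R_{abc}{}^d`, with the convention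
`∇_a ∇_b ω_c - ∇_b ∇_a ω_c = R_{abc}{}^d ω_d`. -/
def riemann (a b c d : Fin 4) : E4 → ℝ := fun y ↦
  pd b (christoffel G d a c) y - pd a (christoffel G d b c) y
    + ∑ e, (christoffel G e a c y * christoffel G d b e y
        - christoffel G e b c y * christoffel G d a e y)

/-- The Ricci tensor `R_{ac} = R_{abc}{}^b`. -/
def ricci (a c : Fin 4) : E4 → ℝ := fun y ↦ ∑ b, riemann G a b c b y

/-- The scalar curvature `R = g^{ac} R_{ac}`. -/
def scalarCurvature : E4 → ℝ := fun y ↦ ∑ a, ∑ c, inv G a c y * ricci G a c y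

/-- The Schouten tensor `L_{ab} = ½ (R_{ab} - (1/6) R g_{ab})`. -/
def schouten (a b : Fin 4) : E4 → ℝ := fun y ↦
  (1 / 2) * (ricci G a b y - (1 / 6) * scalarCurvature G y * G a b y)

/-- The Schouten tensor with one index raised, `L^d{}_b = g^{de} L_{eb}`. -/
def schoutenUp (d b : Fin 4) : E4 → ℝ := fun y ↦ ∑ e, inv G d e y * schouten G e b y

/-- The Weyl tensor
`C_{abc}{}^d = R_{abc}{}^d - 2 L^d{}_{[b} g_{a]c} - 2 δ^d{}_{[b} L_{a]c}`. -/
def weyl (a b c d : Fin 4) : E4 → ℝ := fun y ↦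
  riemann G a b c d y
    - (schoutenUp G d b y * G a c y - schoutenUp G d a y * G b c y)
    - (delta d b * schouten G a c y - delta d a * schouten G b c y)

/-- The covariant Weyl tensor `C_{abcd} = C_{abc}{}^e g_{ed}`. -/
def weylLow (a b c d : Fin 4) : E4 → ℝ := fun y ↦ ∑ e, weyl G a b c e y * G e d y

/-- The Weyl tensor `C_a{}^{bcd}` with its last three indices raised. -/
def weylUp (a b c d : Fin 4) : E4 → ℝ := fun y ↦
  ∑ i, ∑ j, ∑ k, inv G b i y * inv G c j y * inv G d k y * weylLow G a i j k y

/-- The Weyl scalar `C · C = C_{abcd} C^{abcd} = C_{abcd} g^{ae} C_e{}^{bcd}`. -/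
def weylSq : E4 → ℝ := fun y ↦
  ∑ a, ∑ b, ∑ c, ∑ d, ∑ e, weylLow G a b c d y * inv G a e y * weylUp G e b c d y

/-- The covariant derivative `∇_m L_{pa}` of the Schouten tensor. -/
def covSchouten (m p a : Fin 4) : E4 → ℝ := fun y ↦
  pd m (schouten G p a) y
    - ∑ e, (christoffel G e m p y * schouten G e a y + christoffel G e m a y * schouten G p e y)

/-- The covector `Λ_d = 8 C_d{}^{amp} ∇_{[m} L_{p]a} / (C · C)`. -/
def Lam (d : Fin 4) : E4 → ℝ := fun y ↦
  8 * (∑ a, ∑ m, ∑ p,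
    weylUp G d a m p y * ((1 / 2) * (covSchouten G m p a y - covSchouten G p m a y))) / weylSq G y

/-- The operator `D^s_a f = ∇_a f + s Λ_a f` on scalars (where `∇_a f = ∂_a f`). -/
def conformalDiff (s : ℤ) (f : E4 → ℝ) (a : Fin 4) : E4 → ℝ := fun y ↦
  pd a f y + (s : ℝ) * Lam G a y * f y

end Coord

/-- The tangent vector at `φ⁻¹(y)` that the chart `φ` represents by the vector `v` of the model
space, i.e. the image of `v` under the derivative of `φ⁻¹` at `y`. -/
def chartVector {E : Type*} [NormedAddCommGroup E] [NormedSpace ℝ E]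
    {M : Type*} [TopologicalSpace M] [ChartedSpace E M]
    (φ : OpenPartialHomeomorph M E) (y v : E) : TangentSpace 𝓘(ℝ, E) (φ.symm y) :=
  mfderiv 𝓘(ℝ, E) 𝓘(ℝ, E) φ.symm y v

namespace PseudoRiemannianMetric

variable {M : Type*} [TopologicalSpace M] [ChartedSpace E4 M] [IsManifold (𝓡 4) ∞ M]

/-- The coordinate vector field `∂/∂y^i` of a chart `φ`, at the point with coordinates `y`. -/
def coordVector (φ : OpenPartialHomeomorph M E4) (i : Fin 4) (y : E4) :
    TangentSpace (𝓡 4) (φ.symm y) :=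
  chartVector φ y (EuclideanSpace.single i 1)

/-- The components `g_{ij} = g(∂/∂y^i, ∂/∂y^j)` in the chart `φ`, as functions of the
coordinates. -/
def components (g : PseudoRiemannianMetric M) (φ : OpenPartialHomeomorph M E4)
    (i j : Fin 4) : E4 → ℝ :=
  fun y ↦ g.inner (φ.symm y) (coordVector φ i y) (coordVector φ j y)

/-- The scalar `C · C` at the point `x`, computed in the chart `φ`. -/
def weylScalar (g : PseudoRiemannianMetric M) (φ : OpenPartialHomeomorph M E4) (x : M) : ℝ :=
  Coord.weylSq (g.components φ) (φ x)

/-- The component `D^s_a w` at the point `x`, in the chart `φ`, of the operator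
`D^s_a w = ∇_a w + s Λ_a w` of the metric `g`. -/
def conformalDiff (g : PseudoRiemannianMetric M) (s : ℤ) (w : M → ℝ)
    (φ : OpenPartialHomeomorph M E4) (a : Fin 4) (x : M) : ℝ :=
  Coord.conformalDiff (g.components φ) s (w ∘ φ.symm) a (φ x)

/-- `(M, g)` is nondegenerate: the scalar `C · C` vanishes at no point. -/
def WeylNondegenerate (g : PseudoRiemannianMetric M) : Prop :=
  ∀ φ ∈ IsManifold.maximalAtlas (𝓡 4) ∞ M, ∀ x ∈ φ.source, g.weylScalar φ x ≠ 0

/-- `g = Θ² g̃` with a positive function `Θ`. -/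
def ConformallyRelated (g gt : PseudoRiemannianMetric M) (Θ : M → ℝ) : Prop :=
  (∀ x, 0 < Θ x) ∧
    ∀ (x : M) (u v : TangentSpace (𝓡 4) x), g.inner x u v = Θ x ^ 2 * gt.inner x u v

end PseudoRiemannianMetric

end

/-! In a chart, put `f = -log Θ`, so that g̃ = e^{2f} g and w̃ = e^{-sf} w. Everything reduces to
one transformation rule, Λ̃_d = Λ_d + ∂_d f (`IsConformalOn.Lam_eq`): the term -s ∂f produced by
differentiating e^{-sf} then cancels against the shift of s Λ.

Two facts give the rule. First, the Cotton tensor 2∇_{[m}L_{p]a} changes by -C_{mpa}{}^d ∂_d f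
(`cotton_eq`). The Hessian of f in the change of L, differentiated and antisymmetrised, yields
R_{mpa}{}^d ∂_d f by the Ricci identity, and the remaining terms remove the Schouten part of R.
Second, in dimension four C_d{}^{amp} C_{mpa}{}^e = -¼ (C·C) δ_d{}^e (`sum_weylUp_mul_weyl`), so
contracting the change of the Cotton tensor with C_d{}^{amp} returns ∂_d f itself. Since C_{abc}{}^d
is invariant (`weyl_eq`), C_d{}^{amp} and C·C both scale by e^{-4f}, and the scale drops out of the
quotient Λ.

The quadratic identity comes from a statement of pure algebra, `sum_mul_eq_quarter_of_traceFree`;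
applying it requires the antisymmetries, pair symmetry and trace-freeness of the Weyl tensor. -/

namespace Coord

/-! ### Calculus of coordinate partial derivatives. -/

section PartialDerivatives

variable {U : Set E4} {f g : E4 → ℝ} {y : E4}

lemma differentiableAt_of_contDiffOn (hU : IsOpen U) (hf : ContDiffOn ℝ ∞ f U) (hy : y ∈ U) :
    DifferentiableAt ℝ f y :=
  (hf.contDiffAt (hU.mem_nhds hy)).differentiableAt (by simp)

lemma pd_congr (hU : IsOpen U) (hy : y ∈ U) (h : ∀ z ∈ U, f z = g z) (a : Fin 4) :
    pd a f y = pd a g y := by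
  have : f =ᶠ[nhds y] g := Filter.eventuallyEq_of_mem (hU.mem_nhds hy) h
  rw [pd, pd, this.fderiv_eq]

lemma pd_add (hf : DifferentiableAt ℝ f y) (hg : DifferentiableAt ℝ g y) (a : Fin 4) :
    pd a (fun z ↦ f z + g z) y = pd a f y + pd a g y := by
  simp [pd, fderiv_fun_add hf hg]

lemma pd_sub (hf : DifferentiableAt ℝ f y) (hg : DifferentiableAt ℝ g y) (a : Fin 4) :
    pd a (fun z ↦ f z - g z) y = pd a f y - pd a g y := by
  simp [pd, fderiv_fun_sub hf hg]

lemma pd_mul (hf : DifferentiableAt ℝ f y) (hg : DifferentiableAt ℝ g y) (a : Fin 4) :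
    pd a (fun z ↦ f z * g z) y = pd a f y * g y + f y * pd a g y := by
  simp [pd, fderiv_fun_mul hf hg]; ring

lemma pd_const_mul (hf : DifferentiableAt ℝ f y) (c : ℝ) (a : Fin 4) :
    pd a (fun z ↦ c * f z) y = c * pd a f y := by
  simp [pd, fderiv_const_mul hf]

lemma pd_neg (a : Fin 4) : pd a (fun z ↦ -f z) y = -pd a f y := by
  simp [pd, fderiv_fun_neg]

lemma pd_sum {F : Fin 4 → E4 → ℝ} (hF : ∀ i, DifferentiableAt ℝ (F i) y) (a : Fin 4) :
    pd a (fun z ↦ ∑ i, F i z) y = ∑ i, pd a (F i) y := by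
  simp [pd, fderiv_fun_sum (fun i _ ↦ hF i)]

lemma pd_exp (hf : DifferentiableAt ℝ f y) (a : Fin 4) :
    pd a (fun z ↦ Real.exp (f z)) y = Real.exp (f y) * pd a f y := by
  simp [pd, fderiv_exp hf]

lemma contDiffOn_pd (hU : IsOpen U) (hf : ContDiffOn ℝ ∞ f U) (a : Fin 4) :
    ContDiffOn ℝ ∞ (pd a f) U :=
  (hf.fderiv_of_isOpen hU (by simp)).clm_apply contDiffOn_const

lemma pd_comm (hU : IsOpen U) (hf : ContDiffOn ℝ ∞ f U) (hy : y ∈ U) (a b : Fin 4) :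
    pd a (pd b f) y = pd b (pd a f) y := by
  have hd : DifferentiableAt ℝ (fderiv ℝ f) y :=
    ((hf.fderiv_of_isOpen hU (m := ∞) (by simp)).contDiffAt (hU.mem_nhds hy)).differentiableAt
      (by simp)
  have key (c d : Fin 4) : pd c (pd d f) y =
      fderiv ℝ (fderiv ℝ f) y (EuclideanSpace.single c 1) (EuclideanSpace.single d 1) := by
    change fderiv ℝ (fun z ↦ fderiv ℝ f z (EuclideanSpace.single d 1)) y _ = _
    rw [fderiv_clm_apply hd (differentiableAt_const _)]
    simp
  rw [key, key]
  exact (contDiffAt_infty.1 (hf.contDiffAt (hU.mem_nhds hy)) 2).isSymmSndFDerivAt (by simp) _ _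

end PartialDerivatives

/-! ### Metrics in coordinates: inverse, smoothness, raising and lowering. -/

/-- The array `G` gives the components of a smooth pseudo-Riemannian metric on the open set `U`
of coordinates. -/
structure IsMetricOn (G : Fin 4 → Fin 4 → E4 → ℝ) (U : Set E4) : Prop where
  isOpen : IsOpen U
  smooth (i j : Fin 4) : ContDiffOn ℝ ∞ (G i j) U
  symm (i j : Fin 4) (y : E4) : G i j y = G j i y
  det_ne_zero (y : E4) (hy : y ∈ U) : (Matrix.of fun i j ↦ G i j y).det ≠ 0

variable {G : Fin 4 → Fin 4 → E4 → ℝ} {U : Set E4} {y : E4}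

lemma sum_delta_mul (a : Fin 4) (F : Fin 4 → ℝ) : ∑ e, delta a e * F e = F a := by
  simp [delta]

lemma sum_delta_mul' (a : Fin 4) (F : Fin 4 → ℝ) : ∑ e, delta e a * F e = F a := by
  simp [delta]

namespace IsMetricOn

lemma inv_symm (h : IsMetricOn G U) (a b : Fin 4) (y : E4) : inv G a b y = inv G b a y := by
  have hs : (Matrix.of fun i j ↦ G i j y).transpose = Matrix.of fun i j ↦ G i j y := by
    ext i j; exact h.symm j i y
  unfold inv
  conv_lhs => rw [← hs, ← Matrix.transpose_nonsing_inv]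
  rfl

lemma sum_inv_mul (h : IsMetricOn G U) (hy : y ∈ U) (a c : Fin 4) :
    ∑ b, inv G a b y * G b c y = delta a c := by
  have := Matrix.nonsing_inv_mul _ (isUnit_iff_ne_zero.2 (h.det_ne_zero y hy))
  have := congrFun (congrFun this a) c
  simpa [Matrix.mul_apply, Matrix.one_apply, inv, delta] using this

lemma sum_mul_inv (h : IsMetricOn G U) (hy : y ∈ U) (a c : Fin 4) :
    ∑ b, G a b y * inv G b c y = delta a c := by
  have := Matrix.mul_nonsing_inv _ (isUnit_iff_ne_zero.2 (h.det_ne_zero y hy))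
  have := congrFun (congrFun this a) c
  simpa [Matrix.mul_apply, Matrix.one_apply, inv, delta] using this

/-- Cramer's rule: determinants and adjugate entries are polynomials in the components, and the
determinant does not vanish on `U`. -/
lemma contDiffOn_inv (h : IsMetricOn G U) (a b : Fin 4) : ContDiffOn ℝ ∞ (inv G a b) U := by
  have hs := h.smooth
  have hdet (N : Fin 4 → Fin 4 → E4 → ℝ) (hN : ∀ i j, ContDiffOn ℝ ∞ (N i j) U) :
      ContDiffOn ℝ ∞ (fun y ↦ (Matrix.of fun i j ↦ N i j y).det) U := by
    simp only [Matrix.det_apply', Matrix.of_apply]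
    exact ContDiffOn.sum fun σ _ ↦ contDiffOn_const.mul (contDiffOn_prod fun i _ ↦ hN _ _)
  have hadj : ContDiffOn ℝ ∞ (fun y ↦ (Matrix.of fun i j ↦ G i j y).adjugate a b) U := by
    simp only [Matrix.adjugate_apply]
    refine (hdet (fun i j y ↦ (Matrix.of fun i j ↦ G i j y).updateRow b (Pi.single a 1) i j)
      fun i j ↦ ?_)
    by_cases hi : i = b
    · subst hi; simp only [Matrix.updateRow_self]; exact contDiffOn_const
    · simp only [Matrix.updateRow_ne hi]; exact hs i j
  refine ((hdet G hs).inv h.det_ne_zero).mul hadj |>.congr fun y _ ↦ ?_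
  simp [inv, Matrix.inv_def]

lemma contDiffOn_christoffel (h : IsMetricOn G U) (c a b : Fin 4) :
    ContDiffOn ℝ ∞ (christoffel G c a b) U := by
  have hp (a i j : Fin 4) := contDiffOn_pd h.isOpen (h.smooth i j) a
  exact contDiffOn_const.mul (ContDiffOn.sum fun d _ ↦
    (h.contDiffOn_inv c d).mul (((hp _ _ _).add (hp _ _ _)).sub (hp _ _ _)))

lemma contDiffOn_riemann (h : IsMetricOn G U) (a b c d : Fin 4) :
    ContDiffOn ℝ ∞ (riemann G a b c d) U := by
  have hc := h.contDiffOn_christoffel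
  exact ((contDiffOn_pd h.isOpen (hc _ _ _) _).sub (contDiffOn_pd h.isOpen (hc _ _ _) _)).add
    (ContDiffOn.sum fun e _ ↦ ((hc _ _ _).mul (hc _ _ _)).sub ((hc _ _ _).mul (hc _ _ _)))

lemma contDiffOn_ricci (h : IsMetricOn G U) (a c : Fin 4) : ContDiffOn ℝ ∞ (ricci G a c) U :=
  ContDiffOn.sum fun _ _ ↦ h.contDiffOn_riemann _ _ _ _

lemma contDiffOn_scalarCurvature (h : IsMetricOn G U) : ContDiffOn ℝ ∞ (scalarCurvature G) U :=
  ContDiffOn.sum fun _ _ ↦ ContDiffOn.sum fun _ _ ↦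
    (h.contDiffOn_inv _ _).mul (h.contDiffOn_ricci _ _)

lemma contDiffOn_schouten (h : IsMetricOn G U) (a b : Fin 4) :
    ContDiffOn ℝ ∞ (schouten G a b) U :=
  contDiffOn_const.mul ((h.contDiffOn_ricci _ _).sub
    ((contDiffOn_const.mul h.contDiffOn_scalarCurvature).mul (h.smooth _ _)))

/-- Raising and lowering an index are inverse to each other. -/
lemma sum_inv_sum_mul (h : IsMetricOn G U) (hy : y ∈ U) (F : Fin 4 → ℝ) (a : Fin 4) :
    ∑ b, inv G a b y * ∑ c, G b c y * F c = F a := by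
  simp_rw [Finset.mul_sum, ← mul_assoc]
  rw [Finset.sum_comm]
  simp_rw [← Finset.sum_mul, h.sum_inv_mul hy, sum_delta_mul]

lemma sum_mul_sum_inv (h : IsMetricOn G U) (hy : y ∈ U) (F : Fin 4 → ℝ) (a : Fin 4) :
    ∑ b, G a b y * ∑ c, inv G b c y * F c = F a := by
  simp_rw [Finset.mul_sum, ← mul_assoc]
  rw [Finset.sum_comm]
  simp_rw [← Finset.sum_mul, h.sum_mul_inv hy, sum_delta_mul]

end IsMetricOn

end Coord

/-! ### Algebraic symmetries of the Riemann, Ricci, Schouten and Weyl tensors. -/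

namespace Coord

/-- The covariant Riemann tensor `R_{abcd} = R_{abc}{}^e g_{ed}`. -/
noncomputable def riemannLow (G : Fin 4 → Fin 4 → E4 → ℝ) (a b c d : Fin 4) : E4 → ℝ :=
  fun y ↦ ∑ e, riemann G a b c e y * G e d y

/-- An algebraic curvature tensor is symmetric under exchange of its index pairs. -/
lemma pair_symm_of_bianchi (T : Fin 4 → Fin 4 → Fin 4 → Fin 4 → ℝ)
    (h1 : ∀ a b c d, T b a c d = -T a b c d) (h2 : ∀ a b c d, T a b d c = -T a b c d)
    (h3 : ∀ a b c d, T a b c d + T b c a d + T c a b d = 0) (a b c d : Fin 4) :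
    T a b c d = T c d a b := by
  linarith [h3 a b c d, h3 b c d a, h3 c d a b, h3 d a b c, h1 a b c d, h1 b c a d, h1 c a b d,
    h1 b c d a, h1 c d b a, h1 d b c a, h1 c d a b, h1 d a c b, h1 a c d b, h1 d a b c,
    h1 a b d c, h1 b d a c, h2 a b c d, h2 b c a d, h2 c a b d,
    h2 b c d a, h2 c d b a, h2 d b c a, h2 c d a b, h2 d a c b, h2 a c d b, h2 d a b c,
    h2 a b d c, h2 b d a c]

variable {G : Fin 4 → Fin 4 → E4 → ℝ} {U : Set E4} {y : E4}

lemma riemann_swap (a b c d : Fin 4) (y : E4) : riemann G b a c d y = -riemann G a b c d y := by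
  simp only [riemann, Finset.sum_sub_distrib]
  ring

lemma riemannLow_swap (a b c d : Fin 4) (y : E4) :
    riemannLow G b a c d y = -riemannLow G a b c d y := by
  simp only [riemannLow, ← Finset.sum_neg_distrib]
  exact Finset.sum_congr rfl fun e _ ↦ by rw [riemann_swap]; ring

namespace IsMetricOn

/-- Equality as functions, available because `IsMetricOn` asks for symmetry at all points, lets the
indices be exchanged under `pd`. -/
lemma symm_fun (h : IsMetricOn G U) (i j : Fin 4) : G i j = G j i := funext (h.symm i j)

lemma christoffel_symm (h : IsMetricOn G U) (c a b : Fin 4) :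
    christoffel G c a b = christoffel G c b a := by
  funext y
  unfold christoffel
  congr 1
  refine Finset.sum_congr rfl fun d _ ↦ ?_
  rw [h.symm_fun a b]
  ring

/-- The Christoffel symbols of the first kind. -/
lemma sum_mul_christoffel (h : IsMetricOn G U) (hy : y ∈ U) (d a b : Fin 4) :
    ∑ e, christoffel G e a b y * G e d y =
      (1 / 2) * (pd a (G b d) y + pd b (G a d) y - pd d (G a b) y) := by
  rw [← h.sum_mul_sum_inv hy (fun d ↦ pd a (G b d) y + pd b (G a d) y - pd d (G a b) y) d,
    Finset.mul_sum]
  refine Finset.sum_congr rfl fun e _ ↦ ?_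
  rw [h.symm e d, christoffel]
  ring

/-- The Levi-Civita connection is metric. -/
lemma pd_metric (h : IsMetricOn G U) (hy : y ∈ U) (a b c : Fin 4) :
    pd a (G b c) y =
      ∑ e, (christoffel G e a b y * G e c y + christoffel G e a c y * G e b y) := by
  rw [Finset.sum_add_distrib, h.sum_mul_christoffel hy, h.sum_mul_christoffel hy,
    h.symm_fun c b, h.symm_fun a c, h.symm_fun a b]
  ring

lemma differentiableAt_metric (h : IsMetricOn G U) (hy : y ∈ U) (a b : Fin 4) :
    DifferentiableAt ℝ (G a b) y := differentiableAt_of_contDiffOn h.isOpen (h.smooth a b) hy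

lemma differentiableAt_christoffel (h : IsMetricOn G U) (hy : y ∈ U) (a b c : Fin 4) :
    DifferentiableAt ℝ (christoffel G a b c) y :=
  differentiableAt_of_contDiffOn h.isOpen (h.contDiffOn_christoffel a b c) hy

lemma pd_pd_metric (h : IsMetricOn G U) (hy : y ∈ U) (a b c d : Fin 4) :
    pd a (pd b (G c d)) y =
      ∑ e, (pd a (christoffel G e b c) y * G e d y + pd a (christoffel G e b d) y * G e c y)
      + ∑ e, (christoffel G e b c y *
            ∑ k, (christoffel G k a e y * G k d y + christoffel G k a d y * G k e y)
          + christoffel G e b d y *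
            ∑ k, (christoffel G k a e y * G k c y + christoffel G k a c y * G k e y)) := by
  have hG := h.differentiableAt_metric hy
  have hc := h.differentiableAt_christoffel hy
  rw [pd_congr h.isOpen hy (fun z hz ↦ h.pd_metric hz b c d), pd_sum fun e ↦
    (((hc _ _ _).fun_mul (hG _ _)).fun_add ((hc _ _ _).fun_mul (hG _ _))), ← Finset.sum_add_distrib]
  refine Finset.sum_congr rfl fun e _ ↦ ?_
  rw [pd_add ((hc _ _ _).fun_mul (hG _ _)) ((hc _ _ _).fun_mul (hG _ _)),
    pd_mul (hc _ _ _) (hG _ _), pd_mul (hc _ _ _) (hG _ _), h.pd_metric hy, h.pd_metric hy]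
  ring

/-- The commutator of ∂_a and ∂_b on g_{cd} vanishes; rewritten through metric compatibility, it is
R_{abcd} + R_{abdc} up to sign. -/
lemma riemannLow_swap_right (h : IsMetricOn G U) (hy : y ∈ U) (a b c d : Fin 4) :
    riemannLow G a b d c y = -riemannLow G a b c d y := by
  have key := pd_comm h.isOpen (h.smooth c d) hy a b
  rw [h.pd_pd_metric hy, h.pd_pd_metric hy] at key
  simp only [riemannLow, riemann, Fin.sum_univ_four] at key ⊢
  -- The terms Γ^e Γ^k g_{ke} cancel in pairs only after exchanging the two summed indices of the
  -- metric.
  simp only [h.symm 1 0 y, h.symm 2 0 y, h.symm 3 0 y, h.symm 2 1 y, h.symm 3 1 y,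
    h.symm 3 2 y] at key
  linear_combination -key

lemma riemann_bianchi (h : IsMetricOn G U) (a b c d : Fin 4) (y : E4) :
    riemann G a b c d y + riemann G b c a d y + riemann G c a b d y = 0 := by
  have s1 (d : Fin 4) := h.christoffel_symm d b a
  have s2 (d : Fin 4) := h.christoffel_symm d c a
  have s3 (d : Fin 4) := h.christoffel_symm d c b
  simp only [riemann, s1, s2, s3, Finset.sum_sub_distrib]
  ring

lemma riemannLow_bianchi (h : IsMetricOn G U) (a b c d : Fin 4) (y : E4) :
    riemannLow G a b c d y + riemannLow G b c a d y + riemannLow G c a b d y = 0 := by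
  simp only [riemannLow, ← Finset.sum_add_distrib, ← add_mul, h.riemann_bianchi, zero_mul,
    Finset.sum_const_zero]

lemma sum_riemannLow_inv (h : IsMetricOn G U) (hy : y ∈ U) (a b c d : Fin 4) :
    ∑ e, inv G d e y * riemannLow G a b c e y = riemann G a b c d y := by
  rw [← h.sum_inv_sum_mul hy (fun e ↦ riemann G a b c e y) d]
  refine Finset.sum_congr rfl fun e _ ↦ ?_
  rw [riemannLow]
  congr 1
  exact Finset.sum_congr rfl fun k _ ↦ by rw [h.symm]; ring

/-- The trace of an antisymmetric tensor vanishes. -/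
lemma sum_inv_mul_eq_zero (h : IsMetricOn G U) (T : Fin 4 → Fin 4 → ℝ)
    (hT : ∀ a b, T b a = -T a b) : ∑ a, ∑ b, inv G a b y * T a b = 0 := by
  have : ∑ a, ∑ b, inv G a b y * T a b = -∑ a, ∑ b, inv G a b y * T a b := by
    conv_lhs => rw [Finset.sum_comm]
    simp only [← Finset.sum_neg_distrib]
    refine Finset.sum_congr rfl fun a _ ↦ Finset.sum_congr rfl fun b _ ↦ ?_
    rw [h.inv_symm, hT]; ring
  linarith

/-- Contracting the first Bianchi identity, the antisymmetric part of Ricci is a trace of R over its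
last two indices, which is zero. -/
lemma ricci_symm (h : IsMetricOn G U) (hy : y ∈ U) (a c : Fin 4) :
    ricci G a c y = ricci G c a y := by
  have h0 : ∑ b, riemann G c a b b y = 0 := by
    rw [← h.sum_inv_mul_eq_zero (y := y) (fun b e ↦ riemannLow G c a b e y)
      fun _ _ ↦ h.riemannLow_swap_right hy _ _ _ _]
    exact Finset.sum_congr rfl fun b _ ↦ (h.sum_riemannLow_inv hy c a b b).symm
  have h1 : ricci G a c y - ricci G c a y + ∑ b, riemann G c a b b y = 0 := by
    rw [ricci, ricci, ← Finset.sum_sub_distrib, ← Finset.sum_add_distrib]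
    refine Finset.sum_eq_zero fun b _ ↦ ?_
    have := h.riemann_bianchi a b c b y
    rw [riemann_swap c b] at this
    linarith
  linarith

lemma schouten_symm (h : IsMetricOn G U) (hy : y ∈ U) (a b : Fin 4) :
    schouten G a b y = schouten G b a y := by
  rw [schouten, schouten, h.ricci_symm hy, h.symm]

lemma sum_schoutenUp_mul (h : IsMetricOn G U) (hy : y ∈ U) (b d : Fin 4) :
    ∑ e, schoutenUp G e b y * G e d y = schouten G d b y := by
  rw [← h.sum_mul_sum_inv hy (fun e ↦ schouten G e b y) d]
  exact Finset.sum_congr rfl fun e _ ↦ by rw [h.symm, schoutenUp]; ring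

lemma weylLow_eq (h : IsMetricOn G U) (hy : y ∈ U) (a b c d : Fin 4) :
    weylLow G a b c d y = riemannLow G a b c d y
      - (schouten G d b y * G a c y - schouten G d a y * G b c y)
      - (G b d y * schouten G a c y - G a d y * schouten G b c y) := by
  have e1 : ∑ e, schoutenUp G e b y * G a c y * G e d y = schouten G d b y * G a c y := by
    rw [← h.sum_schoutenUp_mul hy, Finset.sum_mul]
    exact Finset.sum_congr rfl fun e _ ↦ by ring
  have e2 : ∑ e, schoutenUp G e a y * G b c y * G e d y = schouten G d a y * G b c y := by
    rw [← h.sum_schoutenUp_mul hy, Finset.sum_mul]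
    exact Finset.sum_congr rfl fun e _ ↦ by ring
  have e3 : ∑ e, delta e b * (schouten G a c y * G e d y) = G b d y * schouten G a c y := by
    rw [sum_delta_mul']; ring
  have e4 : ∑ e, delta e a * (schouten G b c y * G e d y) = G a d y * schouten G b c y := by
    rw [sum_delta_mul']; ring
  rw [← e1, ← e2, ← e3, ← e4, weylLow, riemannLow]
  simp only [← Finset.sum_sub_distrib]
  exact Finset.sum_congr rfl fun e _ ↦ by rw [weyl]; ring

lemma weylLow_swap (h : IsMetricOn G U) (hy : y ∈ U) (a b c d : Fin 4) :
    weylLow G b a c d y = -weylLow G a b c d y := by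
  rw [h.weylLow_eq hy, h.weylLow_eq hy, riemannLow_swap]
  ring

lemma weylLow_swap_right (h : IsMetricOn G U) (hy : y ∈ U) (a b c d : Fin 4) :
    weylLow G a b d c y = -weylLow G a b c d y := by
  rw [h.weylLow_eq hy, h.weylLow_eq hy, h.riemannLow_swap_right hy, h.schouten_symm hy c b,
    h.schouten_symm hy c a, h.schouten_symm hy d b, h.schouten_symm hy d a]
  ring

lemma weylLow_bianchi (h : IsMetricOn G U) (hy : y ∈ U) (a b c d : Fin 4) :
    weylLow G a b c d y + weylLow G b c a d y + weylLow G c a b d y = 0 := by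
  have := h.riemannLow_bianchi a b c d y
  rw [h.weylLow_eq hy, h.weylLow_eq hy, h.weylLow_eq hy, h.schouten_symm hy b a,
    h.schouten_symm hy c a, h.schouten_symm hy c b, h.symm b a, h.symm c a, h.symm c b]
  linear_combination this

lemma weylLow_pair_symm (h : IsMetricOn G U) (hy : y ∈ U) (a b c d : Fin 4) :
    weylLow G a b c d y = weylLow G c d a b y :=
  pair_symm_of_bianchi (fun a b c d ↦ weylLow G a b c d y) (h.weylLow_swap hy)
    (h.weylLow_swap_right hy) (h.weylLow_bianchi hy) a b c d

/-- The Weyl tensor is trace-free. -/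
lemma sum_weyl_eq_zero (h : IsMetricOn G U) (hy : y ∈ U) (a c : Fin 4) :
    ∑ b, weyl G a b c b y = 0 := by
  have e1 : ∑ b, schoutenUp G b b y = (1 / 6) * scalarCurvature G y := by
    have t : ∑ a, ∑ b, inv G a b y * G b a y = 4 := by
      simp [h.sum_inv_mul hy, delta]
    have : ∑ b, schoutenUp G b b y = (1 / 2) * (scalarCurvature G y
        - (1 / 6) * scalarCurvature G y * ∑ a, ∑ b, inv G a b y * G b a y) := by
      conv_rhs => enter [2, 1]; rw [scalarCurvature]
      simp only [Finset.mul_sum, ← Finset.sum_sub_distrib]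
      refine Finset.sum_congr rfl fun b _ ↦ Finset.sum_congr rfl fun e _ ↦ ?_
      rw [schouten, h.ricci_symm hy e b]
      ring
    rw [this, t]; ring
  have e2 : ∑ b, schoutenUp G b a y * G b c y = schouten G c a y := h.sum_schoutenUp_mul hy _ _
  have e3 : ∑ b, delta b a * schouten G b c y = schouten G a c y := sum_delta_mul' _ _
  have e4 : ∑ b : Fin 4, delta b b = 4 := by simp [delta]
  have e5 : schouten G c a y = schouten G a c y := h.schouten_symm hy _ _
  have : ∑ b, weyl G a b c b y = ricci G a c y
      - ((∑ b, schoutenUp G b b y) * G a c y - ∑ b, schoutenUp G b a y * G b c y)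
      - ((∑ b : Fin 4, delta b b) * schouten G a c y - ∑ b, delta b a * schouten G b c y) := by
    simp only [weyl, ricci, Finset.sum_sub_distrib, Finset.sum_mul]
  rw [this, e1, e2, e3, e4, e5, schouten]
  ring

end IsMetricOn
end Coord

/-! ### Derivatives of the conformal factor and the Ricci identity. -/

namespace Coord

noncomputable section

/-- The gradient `∇^a f = g^{ab} ∂_b f`. -/
def grad (G : Fin 4 → Fin 4 → E4 → ℝ) (f : E4 → ℝ) (a : Fin 4) : E4 → ℝ :=
  fun y ↦ ∑ b, inv G a b y * pd b f y

/-- The squared length `∇_a f ∇^a f` of the gradient. -/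
def gradSq (G : Fin 4 → Fin 4 → E4 → ℝ) (f : E4 → ℝ) : E4 → ℝ :=
  fun y ↦ ∑ a, pd a f y * grad G f a y

/-- The Hessian `∇_a ∇_b f`. -/
def hess (G : Fin 4 → Fin 4 → E4 → ℝ) (f : E4 → ℝ) (a b : Fin 4) : E4 → ℝ :=
  fun y ↦ pd a (pd b f) y - ∑ e, christoffel G e a b y * pd e f y

/-- The change of the Schouten tensor under the conformal change `g ↦ e^{2f} g`. -/
def schoutenDiff (G : Fin 4 → Fin 4 → E4 → ℝ) (f : E4 → ℝ) (a b : Fin 4) : E4 → ℝ :=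
  fun y ↦ -hess G f a b y + pd a f y * pd b f y - (1 / 2) * gradSq G f y * G a b y

/-- The tensor `schoutenDiff` with its first index raised. -/
def schoutenDiffUp (G : Fin 4 → Fin 4 → E4 → ℝ) (f : E4 → ℝ) (d b : Fin 4) : E4 → ℝ :=
  fun y ↦ ∑ e, inv G d e y * schoutenDiff G f e b y

/-- The change of the Christoffel symbols under the conformal change `g ↦ e^{2f} g`. -/
def christoffelDiff (G : Fin 4 → Fin 4 → E4 → ℝ) (f : E4 → ℝ) (c a b : Fin 4) : E4 → ℝ :=
  fun y ↦ delta c a * pd b f y + delta c b * pd a f y - G a b y * grad G f c y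

end

/-- The metrics `G` and `Gt` are related on `U` by `g̃ = e^{2f} g`. -/
structure IsConformalOn (G Gt : Fin 4 → Fin 4 → E4 → ℝ) (f : E4 → ℝ) (U : Set E4) : Prop where
  left : IsMetricOn G U
  right : IsMetricOn Gt U
  smooth : ContDiffOn ℝ ∞ f U
  eq (i j : Fin 4) (y : E4) (hy : y ∈ U) : Gt i j y = Real.exp (2 * f y) * G i j y

variable {G Gt : Fin 4 → Fin 4 → E4 → ℝ} {f : E4 → ℝ} {U : Set E4} {y : E4}

lemma sum_christoffelDiff_mul (a b : Fin 4) (F : Fin 4 → ℝ) (y : E4) :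
    ∑ e, christoffelDiff G f e a b y * F e =
      pd b f y * F a + pd a f y * F b - G a b y * ∑ e, grad G f e y * F e := by
  have e1 : ∑ e, delta e a * (pd b f y * F e) = pd b f y * F a := sum_delta_mul' _ _
  have e2 : ∑ e, delta e b * (pd a f y * F e) = pd a f y * F b := sum_delta_mul' _ _
  rw [← e1, ← e2, Finset.mul_sum, ← Finset.sum_add_distrib, ← Finset.sum_sub_distrib]
  exact Finset.sum_congr rfl fun e _ ↦ by rw [christoffelDiff]; ring

namespace IsMetricOn

lemma sum_mul_grad (h : IsMetricOn G U) (hy : y ∈ U) (c : Fin 4) :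
    ∑ d, G c d y * grad G f d y = pd c f y :=
  h.sum_mul_sum_inv hy (fun b ↦ pd b f y) c

lemma contDiffOn_grad (h : IsMetricOn G U) (hf : ContDiffOn ℝ ∞ f U) (a : Fin 4) :
    ContDiffOn ℝ ∞ (grad G f a) U :=
  ContDiffOn.sum fun b _ ↦ (h.contDiffOn_inv a b).mul (contDiffOn_pd h.isOpen hf b)

lemma contDiffOn_gradSq (h : IsMetricOn G U) (hf : ContDiffOn ℝ ∞ f U) :
    ContDiffOn ℝ ∞ (gradSq G f) U :=
  ContDiffOn.sum fun a _ ↦ (contDiffOn_pd h.isOpen hf a).mul (h.contDiffOn_grad hf a)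

lemma contDiffOn_hess (h : IsMetricOn G U) (hf : ContDiffOn ℝ ∞ f U) (a b : Fin 4) :
    ContDiffOn ℝ ∞ (hess G f a b) U :=
  (contDiffOn_pd h.isOpen (contDiffOn_pd h.isOpen hf b) a).sub (ContDiffOn.sum fun e _ ↦
    (h.contDiffOn_christoffel e a b).mul (contDiffOn_pd h.isOpen hf e))

lemma hess_symm (h : IsMetricOn G U) (hf : ContDiffOn ℝ ∞ f U) (hy : y ∈ U) (a b : Fin 4) :
    hess G f a b y = hess G f b a y := by
  simp only [hess, pd_comm h.isOpen hf hy a b, h.christoffel_symm _ a b]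

lemma schoutenDiff_symm (h : IsMetricOn G U) (hf : ContDiffOn ℝ ∞ f U) (hy : y ∈ U)
    (a b : Fin 4) : schoutenDiff G f a b y = schoutenDiff G f b a y := by
  simp only [schoutenDiff, h.hess_symm hf hy a b, h.symm a b, mul_comm]

/-- The covariant derivative of the gradient is the Hessian with one index raised. -/
lemma pd_grad (h : IsMetricOn G U) (hf : ContDiffOn ℝ ∞ f U) (hy : y ∈ U) (b d : Fin 4) :
    pd b (grad G f d) y =
      ∑ e, inv G d e y * hess G f e b y - ∑ e, christoffel G d b e y * grad G f e y := by
  have hg (a : Fin 4) := differentiableAt_of_contDiffOn h.isOpen (h.contDiffOn_grad hf a) hy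
  have hG := h.differentiableAt_metric hy
  have key (c : Fin 4) : ∑ d, G c d y *
      (pd b (grad G f d) y + ∑ e, christoffel G d b e y * grad G f e y) = hess G f c b y := by
    -- Differentiate g_{cd} ∇^d f = ∂_c f instead of the inverse metric, so that only ∂g occurs and
    -- `pd_metric` applies.
    have h1 := pd_congr h.isOpen hy (fun z hz ↦ (h.sum_mul_grad (f := f) hz c).symm) b
    rw [pd_sum fun d ↦ (hG c d).fun_mul (hg d)] at h1
    simp only [pd_mul (hG _ _) (hg _), Finset.sum_add_distrib] at h1
    have h2 : ∑ d, pd b (G c d) y * grad G f d y =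
        ∑ e, christoffel G e b c y * pd e f y +
        ∑ d, G c d y * ∑ e, christoffel G d b e y * grad G f e y := by
      simp only [← h.sum_mul_grad (f := f) hy, h.pd_metric hy, Fin.sum_univ_four, h.symm c]
      ring
    rw [h.hess_symm hf hy c b, hess, h1, h2]
    simp only [mul_add, Finset.sum_add_distrib]
    ring
  have := h.sum_inv_sum_mul hy
    (fun d ↦ pd b (grad G f d) y + ∑ e, christoffel G d b e y * grad G f e y) d
  simp only [key] at this
  linarith

lemma schoutenDiffUp_eq (h : IsMetricOn G U) (hy : y ∈ U) (d b : Fin 4) :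
    schoutenDiffUp G f d b y = -(∑ e, inv G d e y * hess G f e b y)
      + grad G f d y * pd b f y - (1 / 2) * gradSq G f y * delta d b := by
  rw [← h.sum_inv_mul hy d b, grad, schoutenDiffUp, Finset.sum_mul, Finset.mul_sum,
    ← Finset.sum_neg_distrib, ← Finset.sum_add_distrib, ← Finset.sum_sub_distrib]
  exact Finset.sum_congr rfl fun e _ ↦ by rw [schoutenDiff]; ring

lemma pd_gradSq (h : IsMetricOn G U) (hf : ContDiffOn ℝ ∞ f U) (hy : y ∈ U) (m : Fin 4) :
    pd m (gradSq G f) y = 2 * ∑ a, grad G f a y * hess G f m a y := by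
  have hg (a : Fin 4) := differentiableAt_of_contDiffOn h.isOpen (h.contDiffOn_grad hf a) hy
  have hu (a : Fin 4) := differentiableAt_of_contDiffOn h.isOpen (contDiffOn_pd h.isOpen hf a) hy
  have e1 : pd m (gradSq G f) y =
      ∑ a, (pd m (pd a f) y * grad G f a y + pd a f y * pd m (grad G f a) y) := by
    change pd m (fun z ↦ ∑ a, pd a f z * grad G f a z) y = _
    rw [pd_sum fun a ↦ (hu a).fun_mul (hg a)]
    exact Finset.sum_congr rfl fun a _ ↦ pd_mul (hu a) (hg a) m
  have e2 : ∑ a, pd a f y * ∑ e, inv G a e y * hess G f e m y =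
      ∑ a, grad G f a y * hess G f m a y := by
    simp only [grad, Finset.mul_sum, Finset.sum_mul]
    rw [Finset.sum_comm]
    refine Finset.sum_congr rfl fun a _ ↦ Finset.sum_congr rfl fun e _ ↦ ?_
    rw [h.hess_symm hf hy a m, h.inv_symm]; ring
  have e3 : ∑ a, pd a f y * ∑ e, christoffel G a m e y * grad G f e y =
      ∑ a, grad G f a y * ∑ e, christoffel G e m a y * pd e f y := by
    simp only [Finset.mul_sum]
    rw [Finset.sum_comm]
    exact Finset.sum_congr rfl fun a _ ↦ Finset.sum_congr rfl fun e _ ↦ by ring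
  have e4 : ∑ a, pd m (pd a f) y * grad G f a y = ∑ a, grad G f a y * pd m (pd a f) y :=
    Finset.sum_congr rfl fun a _ ↦ mul_comm _ _
  rw [e1]
  simp only [h.pd_grad hf hy, mul_sub, Finset.sum_add_distrib, Finset.sum_sub_distrib, e2, e3, e4]
  simp only [hess, mul_sub, Finset.sum_sub_distrib]
  ring

/-- The Ricci identity for the differential of a function. -/
lemma cov_hess_sub (h : IsMetricOn G U) (hf : ContDiffOn ℝ ∞ f U) (hy : y ∈ U) (m p a : Fin 4) :
    (pd m (hess G f p a) y - ∑ e, christoffel G e m a y * hess G f p e y)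
      - (pd p (hess G f m a) y - ∑ e, christoffel G e p a y * hess G f m e y) =
      ∑ d, riemann G m p a d y * pd d f y := by
  have hus (a : Fin 4) := contDiffOn_pd h.isOpen hf a
  have hu (a : Fin 4) := differentiableAt_of_contDiffOn h.isOpen (hus a) hy
  have huu (a b : Fin 4) :=
    differentiableAt_of_contDiffOn h.isOpen (contDiffOn_pd h.isOpen (hus a) b) hy
  have hc := h.differentiableAt_christoffel hy
  have key (m p : Fin 4) : pd m (hess G f p a) y = pd m (pd p (pd a f)) y -
      ∑ e, (pd m (christoffel G e p a) y * pd e f y +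
        christoffel G e p a y * pd m (pd e f) y) := by
    have hs (e : Fin 4) := (hc e p a).fun_mul (hu e)
    change pd m (fun z ↦ pd p (pd a f) z - ∑ e, christoffel G e p a z * pd e f z) y = _
    rw [pd_sub (huu _ _) (DifferentiableAt.fun_sum fun e _ ↦ hs e), pd_sum hs]
    simp only [pd_mul (hc _ _ _) (hu _)]
  rw [key, key, pd_comm h.isOpen (hus a) hy m p]
  simp only [hess, riemann, Fin.sum_univ_four]
  ring

end IsMetricOn

/-! ### Conformal change of the connection, the curvature and the Cotton tensor. -/

namespace IsConformalOn

lemma inv_eq (h : IsConformalOn G Gt f U) (hy : y ∈ U) (a b : Fin 4) :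
    inv Gt a b y = (Real.exp (2 * f y))⁻¹ * inv G a b y := by
  have hne := (Real.exp_pos (2 * f y)).ne'
  have : (Matrix.of fun i j ↦ Gt i j y)⁻¹ = (Real.exp (2 * f y))⁻¹ •
      (Matrix.of fun i j ↦ G i j y)⁻¹ := by
    refine Matrix.inv_eq_left_inv ?_
    have e : (Matrix.of fun i j ↦ Gt i j y) = Real.exp (2 * f y) • Matrix.of fun i j ↦ G i j y := by
      ext i j; simp [h.eq i j y hy]
    rw [e, Matrix.smul_mul, Matrix.mul_smul, smul_smul, inv_mul_cancel₀ hne, one_smul,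
      Matrix.nonsing_inv_mul _ (isUnit_iff_ne_zero.2 (h.left.det_ne_zero y hy))]
  simp [inv, this]

lemma pd_metric_eq (h : IsConformalOn G Gt f U) (hy : y ∈ U) (a b c : Fin 4) :
    pd a (Gt b c) y = Real.exp (2 * f y) * (2 * pd a f y * G b c y + pd a (G b c) y) := by
  have hf := differentiableAt_of_contDiffOn h.left.isOpen h.smooth hy
  rw [pd_congr h.left.isOpen hy (h.eq b c), pd_mul (hf.const_mul 2).exp
    (h.left.differentiableAt_metric hy b c), pd_exp (hf.const_mul 2), pd_const_mul hf]
  ring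

lemma christoffel_eq (h : IsConformalOn G Gt f U) (hy : y ∈ U) (c a b : Fin 4) :
    christoffel Gt c a b y = christoffel G c a b y + christoffelDiff G f c a b y := by
  have hne := (Real.exp_pos (2 * f y)).ne'
  rw [christoffelDiff, ← h.left.sum_inv_mul hy c a, ← h.left.sum_inv_mul hy c b, grad, christoffel,
    christoffel]
  simp only [Finset.mul_sum, Finset.sum_mul, ← Finset.sum_add_distrib, ← Finset.sum_sub_distrib]
  refine Finset.sum_congr rfl fun d _ ↦ ?_
  rw [h.pd_metric_eq hy, h.pd_metric_eq hy, h.pd_metric_eq hy, h.inv_eq hy, h.left.symm d a,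
    h.left.symm d b]
  field_simp
  ring

lemma pd_christoffel_eq (h : IsConformalOn G Gt f U) (hy : y ∈ U) (b d a c : Fin 4) :
    pd b (christoffel Gt d a c) y = pd b (christoffel G d a c) y
      + (delta d a * pd b (pd c f) y + delta d c * pd b (pd a f) y
        - (pd b (G a c) y * grad G f d y + G a c y * pd b (grad G f d) y)) := by
  have hU := h.left.isOpen
  have hg (a : Fin 4) := differentiableAt_of_contDiffOn hU (h.left.contDiffOn_grad h.smooth a) hy
  have hu (a : Fin 4) := differentiableAt_of_contDiffOn hU (contDiffOn_pd hU h.smooth a) hy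
  have hG := h.left.differentiableAt_metric hy
  have hc := h.left.differentiableAt_christoffel hy
  rw [pd_congr hU hy (fun z hz ↦ h.christoffel_eq hz d a c)]
  simp only [christoffelDiff]
  have h1 := (hu c).const_mul (delta d a)
  have h2 := (hu a).const_mul (delta d c)
  have h3 := (hG a c).fun_mul (hg d)
  rw [pd_add (hc _ _ _) ((h1.fun_add h2).fun_sub h3), pd_sub (h1.fun_add h2) h3, pd_add h1 h2,
    pd_mul (hG _ _) (hg _), pd_const_mul (hu _), pd_const_mul (hu _)]

/-- The correction has exactly the shape in which the Schouten tensor enters the Weyl tensor, with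
`schoutenDiff` in place of L; this is the source of the invariance of C. -/
lemma riemann_eq (h : IsConformalOn G Gt f U) (hy : y ∈ U) (a b c d : Fin 4) :
    riemann Gt a b c d y = riemann G a b c d y
      + (schoutenDiffUp G f d b y * G a c y - schoutenDiffUp G f d a y * G b c y)
      + (delta d b * schoutenDiff G f a c y - delta d a * schoutenDiff G f b c y) := by
  have hm := h.left
  -- Write Γ̃ = Γ + Q with Q = `christoffelDiff`. The four lines on the right are the contracted
  -- products ΓΓ, ΓQ, QΓ and QQ.
  have key (a b : Fin 4) : ∑ e, christoffel Gt e a c y * christoffel Gt d b e y =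
      ∑ e, christoffel G e a c y * christoffel G d b e y
      + (delta d b * ∑ e, christoffel G e a c y * pd e f y + christoffel G d a c y * pd b f y
        - grad G f d y * ∑ e, christoffel G e a c y * G e b y)
      + (pd c f y * christoffel G d b a y + pd a f y * christoffel G d b c y
        - G a c y * ∑ e, christoffel G d b e y * grad G f e y)
      + (pd c f y * christoffelDiff G f d b a y + pd a f y * christoffelDiff G f d b c y
        - G a c y * (delta d b * gradSq G f y)) := by
    have e1 : ∑ e, christoffel G e a c y * christoffelDiff G f d b e y =
        delta d b * ∑ e, christoffel G e a c y * pd e f y + christoffel G d a c y * pd b f y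
        - grad G f d y * ∑ e, christoffel G e a c y * G e b y := by
      have : ∑ e, delta d e * (christoffel G e a c y * pd b f y) =
        christoffel G d a c y * pd b f y := sum_delta_mul _ _
      rw [← this, Finset.mul_sum, Finset.mul_sum, ← Finset.sum_add_distrib,
        ← Finset.sum_sub_distrib]
      refine Finset.sum_congr rfl fun e _ ↦ ?_
      rw [christoffelDiff, hm.symm b e]; ring
    have e2 : ∑ e, grad G f e y * christoffelDiff G f d b e y = delta d b * gradSq G f y := by
      have t1 : ∑ e, delta d e * (grad G f e y * pd b f y) = grad G f d y * pd b f y :=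
        sum_delta_mul _ _
      have t2 : ∑ e, grad G f e y * christoffelDiff G f d b e y =
          delta d b * gradSq G f y + ∑ e, delta d e * (grad G f e y * pd b f y)
          - grad G f d y * ∑ e, G b e y * grad G f e y := by
        rw [gradSq, Finset.mul_sum, Finset.mul_sum, ← Finset.sum_add_distrib,
          ← Finset.sum_sub_distrib]
        exact Finset.sum_congr rfl fun e _ ↦ by rw [christoffelDiff]; ring
      rw [t2, t1, hm.sum_mul_grad hy]; ring
    have e3 : ∑ e, christoffel G d b e y * grad G f e y =
        ∑ e, grad G f e y * christoffel G d b e y :=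
      Finset.sum_congr rfl fun e _ ↦ mul_comm _ _
    rw [← e1, ← e2, e3, ← sum_christoffelDiff_mul a c (fun e ↦ christoffel G d b e y),
      ← sum_christoffelDiff_mul a c (fun e ↦ christoffelDiff G f d b e y)]
    simp only [← Finset.sum_add_distrib]
    refine Finset.sum_congr rfl fun e _ ↦ ?_
    rw [h.christoffel_eq hy, h.christoffel_eq hy]; ring
  have hR (G : Fin 4 → Fin 4 → E4 → ℝ) : riemann G a b c d y =
    pd b (christoffel G d a c) y - pd a (christoffel G d b c) y
    + (∑ e, christoffel G e a c y * christoffel G d b e y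
        - ∑ e, christoffel G e b c y * christoffel G d a e y) := by
    rw [riemann, Finset.sum_sub_distrib]
  rw [hR, hR, key, key, h.pd_christoffel_eq hy, h.pd_christoffel_eq hy, hm.pd_metric hy,
    hm.pd_metric hy, hm.pd_grad h.smooth hy, hm.pd_grad h.smooth hy, hm.schoutenDiffUp_eq hy,
    hm.schoutenDiffUp_eq hy]
  simp only [Finset.sum_add_distrib, schoutenDiff, christoffelDiff, hess, hm.symm b a,
    hm.christoffel_symm _ b a, pd_comm hm.isOpen h.smooth hy b a]
  ring

lemma ricci_eq (h : IsConformalOn G Gt f U) (hy : y ∈ U) (a c : Fin 4) :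
    ricci Gt a c y = ricci G a c y + 2 * schoutenDiff G f a c y
      + (∑ b, schoutenDiffUp G f b b y) * G a c y := by
  have e1 : ∑ b, schoutenDiffUp G f b a y * G b c y = schoutenDiff G f a c y := by
    rw [h.left.schoutenDiff_symm h.smooth hy,
      ← h.left.sum_mul_sum_inv hy (fun e ↦ schoutenDiff G f e a y) c]
    exact Finset.sum_congr rfl fun e _ ↦ by rw [h.left.symm, schoutenDiffUp]; ring
  have e2 : ∑ b, delta b a * schoutenDiff G f b c y = schoutenDiff G f a c y := sum_delta_mul' _ _
  have e3 : ∑ b : Fin 4, delta b b = 4 := by simp [delta]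
  have : ricci Gt a c y = ricci G a c y
      + ((∑ b, schoutenDiffUp G f b b y) * G a c y - ∑ b, schoutenDiffUp G f b a y * G b c y)
      + ((∑ b : Fin 4, delta b b) * schoutenDiff G f a c y
        - ∑ b, delta b a * schoutenDiff G f b c y) := by
    simp only [ricci, h.riemann_eq hy, Finset.sum_add_distrib, Finset.sum_sub_distrib,
      Finset.sum_mul]
  rw [this, e1, e2, e3]
  ring

lemma scalarCurvature_eq (h : IsConformalOn G Gt f U) (hy : y ∈ U) :
    scalarCurvature Gt y = (Real.exp (2 * f y))⁻¹ *
      (scalarCurvature G y + 6 * ∑ b, schoutenDiffUp G f b b y) := by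
  have t : ∑ a, ∑ b, inv G a b y * G a b y = 4 := by
    have (a : Fin 4) : ∑ b, inv G a b y * G a b y = 1 := by
      simp_rw [h.left.symm a, h.left.sum_inv_mul hy]
      simp [delta]
    simp [this]
  have t2 : ∑ a, ∑ b, inv G a b y * schoutenDiff G f a b y = ∑ b, schoutenDiffUp G f b b y := by
    refine Finset.sum_congr rfl fun a _ ↦ Finset.sum_congr rfl fun b _ ↦ ?_
    rw [h.left.schoutenDiff_symm h.smooth hy]
  have : scalarCurvature Gt y = (Real.exp (2 * f y))⁻¹ * (scalarCurvature G y
      + 2 * (∑ a, ∑ b, inv G a b y * schoutenDiff G f a b y)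
      + (∑ b, schoutenDiffUp G f b b y) * ∑ a, ∑ b, inv G a b y * G a b y) := by
    simp only [scalarCurvature]
    -- The trace is kept opaque so that `Finset.mul_sum` does not distribute into it.
    generalize hs : ∑ b, schoutenDiffUp G f b b y = s
    simp only [Finset.mul_sum, ← Finset.sum_add_distrib]
    refine Finset.sum_congr rfl fun a _ ↦ Finset.sum_congr rfl fun b _ ↦ ?_
    rw [h.inv_eq hy, h.ricci_eq hy, hs]
    ring
  rw [this, t, t2]
  ring

/-- The coefficient 1/6 is the one for which the trace terms in the changes of R_{ab} and R g_{ab}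
cancel. -/
lemma schouten_eq (h : IsConformalOn G Gt f U) (hy : y ∈ U) (a b : Fin 4) :
    schouten Gt a b y = schouten G a b y + schoutenDiff G f a b y := by
  have hne := (Real.exp_pos (2 * f y)).ne'
  rw [schouten, schouten, h.scalarCurvature_eq hy, h.ricci_eq hy, h.eq a b y hy]
  field_simp
  ring

lemma schoutenUp_eq (h : IsConformalOn G Gt f U) (hy : y ∈ U) (d b : Fin 4) :
    schoutenUp Gt d b y =
      (Real.exp (2 * f y))⁻¹ * (schoutenUp G d b y + schoutenDiffUp G f d b y) := by
  simp only [schoutenUp, schoutenDiffUp, ← Finset.sum_add_distrib, Finset.mul_sum]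
  refine Finset.sum_congr rfl fun e _ ↦ ?_
  rw [h.inv_eq hy, h.schouten_eq hy]
  ring

/-- The Weyl tensor `C_{abc}{}^d` is conformally invariant. -/
lemma weyl_eq (h : IsConformalOn G Gt f U) (hy : y ∈ U) (a b c d : Fin 4) :
    weyl Gt a b c d y = weyl G a b c d y := by
  have hne := (Real.exp_pos (2 * f y)).ne'
  rw [weyl, weyl, h.riemann_eq hy, h.schoutenUp_eq hy, h.schoutenUp_eq hy, h.schouten_eq hy,
    h.schouten_eq hy, h.eq a c y hy, h.eq b c y hy]
  field_simp
  ring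

/-- The conformal change of the Cotton tensor `2 ∇_{[m} L_{p]a}`. -/
lemma cotton_eq (h : IsConformalOn G Gt f U) (hy : y ∈ U) (m p a : Fin 4) :
    covSchouten Gt m p a y - covSchouten Gt p m a y =
      covSchouten G m p a y - covSchouten G p m a y - ∑ d, weyl G m p a d y * pd d f y := by
  have hm := h.left
  have hU := hm.isOpen
  -- The connection is torsion-free, so the terms with Γ^e_{mp} drop out under antisymmetrisation in
  -- m, p.
  have hcot {G : Fin 4 → Fin 4 → E4 → ℝ} (hm : IsMetricOn G U) :
      covSchouten G m p a y - covSchouten G p m a y =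
      (pd m (schouten G p a) y - ∑ e, christoffel G e m a y * schouten G p e y)
      - (pd p (schouten G m a) y - ∑ e, christoffel G e p a y * schouten G m e y) := by
    simp only [covSchouten, Finset.sum_add_distrib, hm.christoffel_symm _ p m]
    ring
  have hpd (m p : Fin 4) : pd m (schouten Gt p a) y = pd m (schouten G p a) y
      + (-pd m (hess G f p a) y + (pd m (pd p f) y * pd a f y + pd p f y * pd m (pd a f) y)
        - (1 / 2) * (pd m (gradSq G f) y * G p a y + gradSq G f y * pd m (G p a) y)) := by
    have hL := differentiableAt_of_contDiffOn hU (hm.contDiffOn_schouten p a) hy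
    have hu (a : Fin 4) := differentiableAt_of_contDiffOn hU (contDiffOn_pd hU h.smooth a) hy
    have hh := differentiableAt_of_contDiffOn hU (hm.contDiffOn_hess h.smooth p a) hy
    have hs := differentiableAt_of_contDiffOn hU (hm.contDiffOn_gradSq h.smooth) hy
    have hG := hm.differentiableAt_metric hy p a
    have h1 := hh.fun_neg.fun_add ((hu p).fun_mul (hu a))
    have h2 := (hs.const_mul (1 / 2)).fun_mul hG
    rw [pd_congr hU hy (fun z hz ↦ h.schouten_eq hz p a)]
    simp only [schoutenDiff]
    rw [pd_add hL (h1.fun_sub h2), pd_sub h1 h2, pd_add hh.fun_neg ((hu p).fun_mul (hu a)), pd_neg,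
      pd_mul (hu p) (hu a), pd_mul (hs.const_mul (1 / 2)) hG, pd_const_mul hs]
    ring
  have hsum (m p : Fin 4) : ∑ e, christoffel Gt e m a y * schouten Gt p e y =
      ∑ e, christoffel G e m a y * schouten G p e y
      - ∑ e, christoffel G e m a y * hess G f p e y
      + pd p f y * ∑ e, christoffel G e m a y * pd e f y
      - (1 / 2) * gradSq G f y * ∑ e, christoffel G e m a y * G e p y
      + (pd a f y * (schouten G p m y + schoutenDiff G f p m y)
        + pd m f y * (schouten G p a y + schoutenDiff G f p a y)
        - G m a y * (∑ e, grad G f e y * schouten G p e y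
          - ∑ e, grad G f e y * hess G f p e y + (1 / 2) * gradSq G f y * pd p f y)) := by
    have e1 : ∑ e, grad G f e y * schouten G p e y
          - ∑ e, grad G f e y * hess G f p e y + (1 / 2) * gradSq G f y * pd p f y =
        ∑ e, grad G f e y * (schouten G p e y + schoutenDiff G f p e y) := by
      have t : (1 / 2) * gradSq G f y * pd p f y = gradSq G f y * pd p f y -
          (1 / 2) * gradSq G f y * ∑ e, G p e y * grad G f e y := by
        rw [hm.sum_mul_grad hy]; ring
      have t2 : gradSq G f y * pd p f y = ∑ a, pd a f y * grad G f a y * pd p f y := by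
        rw [gradSq, Finset.sum_mul]
      rw [t, t2]
      simp only [Finset.mul_sum, ← Finset.sum_sub_distrib, ← Finset.sum_add_distrib]
      exact Finset.sum_congr rfl fun e _ ↦ by rw [schoutenDiff]; ring
    rw [e1, ← sum_christoffelDiff_mul m a (fun e ↦ schouten G p e y + schoutenDiff G f p e y)]
    simp only [Finset.mul_sum, ← Finset.sum_sub_distrib, ← Finset.sum_add_distrib]
    refine Finset.sum_congr rfl fun e _ ↦ ?_
    rw [h.christoffel_eq hy, h.schouten_eq hy, schoutenDiff, hm.symm p e]
    ring
  have hup (p : Fin 4) : ∑ d, schoutenUp G d p y * pd d f y =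
      ∑ e, grad G f e y * schouten G p e y := by
    simp only [schoutenUp, grad, Finset.sum_mul]
    rw [Finset.sum_comm]
    refine Finset.sum_congr rfl fun e _ ↦ Finset.sum_congr rfl fun d _ ↦ ?_
    rw [hm.inv_symm, hm.schouten_symm hy e p]; ring
  have hd (p : Fin 4) : ∑ d, delta d p * pd d f y = pd p f y := sum_delta_mul' _ _
  have hweyl : ∑ d, weyl G m p a d y * pd d f y = ∑ d, riemann G m p a d y * pd d f y
      - ((∑ e, grad G f e y * schouten G p e y) * G m a y
        - (∑ e, grad G f e y * schouten G m e y) * G p a y)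
      - (pd p f y * schouten G m a y - pd m f y * schouten G p a y) := by
    rw [← hup, ← hup, ← hd p, ← hd m]
    simp only [Finset.sum_mul, ← Finset.sum_sub_distrib]
    exact Finset.sum_congr rfl fun e _ ↦ by rw [weyl]; ring
  -- The only third derivatives of f come from the antisymmetrised derivative of the Hessian; the
  -- Ricci identity trades them for curvature.
  have hric := hm.cov_hess_sub h.smooth hy m p a
  rw [hcot h.right, hcot hm, hpd, hpd, hsum, hsum, hweyl, ← hric, hm.pd_gradSq h.smooth hy,
    hm.pd_gradSq h.smooth hy, hm.pd_metric hy, hm.pd_metric hy, hm.schouten_symm hy p m,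
    hm.schoutenDiff_symm h.smooth hy p m]
  simp only [Finset.sum_add_distrib, schoutenDiff, hess, hm.christoffel_symm _ p m,
    pd_comm hU h.smooth hy p m]
  ring

end IsConformalOn

end Coord

/-! ### The quadratic identity in dimension four. -/

namespace Coord

/-- A dimension-dependent identity: in dimension four, the square of a trace-free double two-form
`X^{ab}{}_{cd}`, contracted on three index pairs, is a multiple of the identity. -/
lemma sum_mul_eq_quarter_of_traceFree (X : Fin 4 → Fin 4 → Fin 4 → Fin 4 → ℝ)
    (h1 : ∀ a b c d, X b a c d = -X a b c d) (h2 : ∀ a b c d, X a b d c = -X a b c d)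
    (ht : ∀ a c, ∑ b, X a b c b = 0) (a e : Fin 4) :
    ∑ b, ∑ c, ∑ d, X a b c d * X c d e b =
      (1 / 4) * delta a e * ∑ f, ∑ b, ∑ c, ∑ d, X f b c d * X c d f b := by
  have z1 (a c d : Fin 4) : X a a c d = 0 := by linarith [h1 a a c d]
  have z2 (a c d : Fin 4) : X c d a a = 0 := by linarith [h2 c d a a]
  have e1 (c d : Fin 4) := h1 0 1 c d
  have e2 (c d : Fin 4) := h1 0 2 c d
  have e3 (c d : Fin 4) := h1 0 3 c d
  have e4 (c d : Fin 4) := h1 1 2 c d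
  have e5 (c d : Fin 4) := h1 1 3 c d
  have e6 (c d : Fin 4) := h1 2 3 c d
  have f1 (c d : Fin 4) := h2 c d 0 1
  have f2 (c d : Fin 4) := h2 c d 0 2
  have f3 (c d : Fin 4) := h2 c d 0 3
  have f4 (c d : Fin 4) := h2 c d 1 2
  have f5 (c d : Fin 4) := h2 c d 1 3
  have f6 (c d : Fin 4) := h2 c d 2 3
  simp only [Fin.sum_univ_four] at ht
  have t00 := ht 0 0
  have t01 := ht 0 1
  have t02 := ht 0 2
  have t03 := ht 0 3
  have t10 := ht 1 0
  have t11 := ht 1 1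
  have t12 := ht 1 2
  have t13 := ht 1 3
  have t20 := ht 2 0
  have t21 := ht 2 1
  have t22 := ht 2 2
  have t23 := ht 2 3
  have t30 := ht 3 0
  have t31 := ht 3 1
  have t32 := ht 3 2
  have t33 := ht 3 3
  simp only [z1, z2, e1, e2, e3, e4, e5, e6, f1, f2, f3, f4, f5, f6, zero_add, add_zero, neg_neg]
    at t00 t01 t02 t03 t10 t11 t12 t13 t20 t21 t22 t23 t30 t31 t32 t33
  -- Antisymmetry leaves 36 components. The sixteen trace equations are solved here for sixteen of
  -- them, leaving 20 free; no pair symmetry of `X` is assumed.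
  have s01 : X 0 3 1 3 = -X 0 2 1 2 := by linarith
  have s02 : X 0 3 2 3 = X 0 1 1 2 := by linarith
  have s03 : X 0 2 2 3 = -X 0 1 1 3 := by linarith
  have s10 : X 1 3 0 3 = -X 1 2 0 2 := by linarith
  have s12 : X 1 3 2 3 = -X 0 1 0 2 := by linarith
  have s13 : X 1 2 2 3 = X 0 1 0 3 := by linarith
  have s20 : X 2 3 0 3 = X 1 2 0 1 := by linarith
  have s21 : X 2 3 1 3 = -X 0 2 0 1 := by linarith
  have s23 : X 1 2 1 3 = -X 0 2 0 3 := by linarith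
  have s30 : X 2 3 0 2 = -X 1 3 0 1 := by linarith
  have s31 : X 2 3 1 2 = X 0 3 0 1 := by linarith
  have s32 : X 1 3 1 2 = -X 0 3 0 2 := by linarith
  have s00 : X 0 3 0 3 = -X 0 1 0 1 - X 0 2 0 2 := by linarith
  have s11 : X 1 2 1 2 = -X 0 1 0 1 - X 0 2 0 2 := by linarith
  have s22 : X 1 3 1 3 = X 0 2 0 2 := by linarith
  have s33 : X 2 3 2 3 = X 0 1 0 1 := by linarith
  -- The contraction is diagonal with four equal entries, checked as polynomials in the free
  -- components. Its trace is four times the (0,0) entry, whence the factor 1/4.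
  have key (a e : Fin 4) : ∑ b, ∑ c, ∑ d, X a b c d * X c d e b =
      delta a e * ∑ b, ∑ c, ∑ d, X 0 b c d * X c d 0 b := by
    fin_cases a <;> fin_cases e <;>
    simp only [delta, Fin.sum_univ_four, Fin.zero_eta, Fin.mk_one, Fin.reduceFinMk, Fin.reduceEq,
      if_true, if_false, Fin.isValue, zero_ne_one, one_ne_zero,
      z1, z2, e1, e2, e3, e4, e5, e6, f1, f2, f3, f4, f5, f6, mul_zero, zero_mul, zero_add,
      add_zero, neg_mul_neg, s01, s02, s03, s10, s12, s13, s20, s21, s23, s30, s31, s32, s00, s11,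
      s22, s33] <;> ring
  rw [Finset.sum_congr rfl fun f _ ↦ key f f, key a e]
  simp only [delta, if_true, Finset.sum_const, Finset.card_univ, Fintype.card_fin, nsmul_eq_mul]
  push_cast
  ring

end Coord

/-! ### Contractions of the Weyl tensor and the conformal change of Λ. -/

namespace Coord

/-- The Weyl tensor `C_{ab}{}^{cd}` with its last two indices raised. -/
noncomputable def weylMixed (G : Fin 4 → Fin 4 → E4 → ℝ) (a b c d : Fin 4) : E4 → ℝ :=
  fun y ↦ ∑ i, inv G c i y * weyl G a b i d y

variable {G Gt : Fin 4 → Fin 4 → E4 → ℝ} {f : E4 → ℝ} {U : Set E4} {y : E4}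

/-- Taking index pairs as single indices, this reorders up to six nested sums at once. -/
lemma sum_sum_sum_reverse {α β γ : Type*} [Fintype α] [Fintype β] [Fintype γ] (F : α → β → γ → ℝ) :
    ∑ p, ∑ q, ∑ r, F p q r = ∑ r, ∑ q, ∑ p, F p q r := by
  rw [Finset.sum_comm]
  rw [Finset.sum_congr rfl fun q _ ↦ Finset.sum_comm]
  rw [Finset.sum_comm]

namespace IsMetricOn

lemma sum_inv_weylLow (h : IsMetricOn G U) (hy : y ∈ U) (a b c d : Fin 4) :
    ∑ k, inv G d k y * weylLow G a b c k y = weyl G a b c d y := by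
  rw [← h.sum_inv_sum_mul hy (fun e ↦ weyl G a b c e y) d]
  refine Finset.sum_congr rfl fun e _ ↦ ?_
  rw [weylLow]
  congr 1
  exact Finset.sum_congr rfl fun k _ ↦ by rw [h.symm]; ring

lemma weylMixed_eq (h : IsMetricOn G U) (hy : y ∈ U) (a b c d : Fin 4) :
    weylMixed G a b c d y = ∑ i, ∑ k, inv G c i y * inv G d k y * weylLow G a b i k y := by
  simp only [weylMixed, ← h.sum_inv_weylLow hy, Finset.mul_sum, mul_assoc]

lemma weylMixed_swap (h : IsMetricOn G U) (hy : y ∈ U) (a b c d : Fin 4) :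
    weylMixed G b a c d y = -weylMixed G a b c d y := by
  simp only [h.weylMixed_eq hy, h.weylLow_swap hy a b, mul_neg, Finset.sum_neg_distrib]

lemma weylMixed_swap_right (h : IsMetricOn G U) (hy : y ∈ U) (a b c d : Fin 4) :
    weylMixed G a b d c y = -weylMixed G a b c d y := by
  rw [h.weylMixed_eq hy, h.weylMixed_eq hy, Finset.sum_comm]
  simp only [← Finset.sum_neg_distrib]
  refine Finset.sum_congr rfl fun i _ ↦ Finset.sum_congr rfl fun k _ ↦ ?_
  rw [h.weylLow_swap_right hy a b i k]
  ring

lemma sum_weylMixed_eq_zero (h : IsMetricOn G U) (hy : y ∈ U) (a c : Fin 4) :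
    ∑ b, weylMixed G a b c b y = 0 := by
  simp only [weylMixed]
  rw [Finset.sum_comm]
  simp only [← Finset.mul_sum, h.sum_weyl_eq_zero hy, mul_zero, Finset.sum_const_zero]

lemma weylUp_eq (h : IsMetricOn G U) (hy : y ∈ U) (a b c d : Fin 4) :
    weylUp G a b c d y = ∑ i, inv G b i y * weylMixed G a i c d y := by
  simp only [weylUp, h.weylMixed_eq hy, Finset.mul_sum, mul_assoc]

/-- Pair symmetry turns C·C into the trace of the square of C_{ab}{}^{cd}, the form in which the
algebraic identity produces it. -/
lemma weylSq_eq (h : IsMetricOn G U) (hy : y ∈ U) :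
    weylSq G y = ∑ a, ∑ b, ∑ c, ∑ d, weylMixed G a b c d y * weylMixed G c d a b y := by
  have e1 : weylSq G y = ∑ a, ∑ b, ∑ c, ∑ d, ∑ e, ∑ i,
      weylLow G a b c d y * inv G a e y * (inv G b i y * weylMixed G e i c d y) := by
    simp only [weylSq, h.weylUp_eq hy, Finset.mul_sum]
  have e2 := sum_sum_sum_reverse (fun (p q r : Fin 4 × Fin 4) ↦
    weylLow G p.1 p.2 q.1 q.2 y * inv G p.1 r.1 y *
      (inv G p.2 r.2 y * weylMixed G r.1 r.2 q.1 q.2 y))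
  simp only [Fintype.sum_prod_type] at e2
  rw [e1, e2]
  refine Finset.sum_congr rfl fun e _ ↦ Finset.sum_congr rfl fun i _ ↦
    Finset.sum_congr rfl fun c _ ↦ Finset.sum_congr rfl fun d _ ↦ ?_
  rw [h.weylMixed_eq hy c d e i]
  simp only [Finset.mul_sum]
  refine Finset.sum_congr rfl fun a _ ↦ Finset.sum_congr rfl fun b _ ↦ ?_
  rw [h.weylLow_pair_symm hy a b c d, h.inv_symm a e, h.inv_symm b i]
  ring

/-- The four-dimensional identity `C_d{}^{amp} C_{mpa}{}^e = -¼ (C · C) δ_d{}^e`. -/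
lemma sum_weylUp_mul_weyl (h : IsMetricOn G U) (hy : y ∈ U) (d e : Fin 4) :
    ∑ a, ∑ m, ∑ p, weylUp G d a m p y * weyl G m p a e y =
      -(1 / 4) * delta d e * weylSq G y := by
  have key := sum_mul_eq_quarter_of_traceFree (fun a b c d ↦ weylMixed G a b c d y)
    (h.weylMixed_swap hy) (h.weylMixed_swap_right hy) (h.sum_weylMixed_eq_zero hy) d e
  have e1 : ∑ a, ∑ m, ∑ p, weylUp G d a m p y * weyl G m p a e y =
      ∑ a, ∑ m, ∑ p, ∑ i, inv G a i y * weylMixed G d i m p y * weyl G m p a e y := by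
    simp only [h.weylUp_eq hy, Finset.sum_mul]
  have e2 := sum_sum_sum_reverse (fun (a : Fin 4) (q : Fin 4 × Fin 4) (i : Fin 4) ↦
    inv G a i y * weylMixed G d i q.1 q.2 y * weyl G q.1 q.2 a e y)
  simp only [Fintype.sum_prod_type] at e2
  rw [e1, e2, h.weylSq_eq hy, neg_mul, neg_mul, ← key]
  simp only [← Finset.sum_neg_distrib]
  refine Finset.sum_congr rfl fun i _ ↦ Finset.sum_congr rfl fun m _ ↦
    Finset.sum_congr rfl fun p _ ↦ ?_
  -- The minus sign in the result: raising a in C_{mpa}{}^e puts e last, while the algebraic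
  -- identity has it third.
  rw [← mul_neg, ← h.weylMixed_swap_right hy m p e i,
    show weylMixed G m p i e y = ∑ a, inv G i a y * weyl G m p a e y from rfl, Finset.mul_sum]
  refine Finset.sum_congr rfl fun a _ ↦ ?_
  rw [h.inv_symm a i]
  ring

end IsMetricOn

namespace IsConformalOn

lemma weylLow_eq (h : IsConformalOn G Gt f U) (hy : y ∈ U) (a b c d : Fin 4) :
    weylLow Gt a b c d y = Real.exp (2 * f y) * weylLow G a b c d y := by
  simp only [weylLow, Finset.mul_sum]
  refine Finset.sum_congr rfl fun e _ ↦ ?_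
  rw [h.weyl_eq hy, h.eq e d y hy]
  ring

lemma weylUp_eq (h : IsConformalOn G Gt f U) (hy : y ∈ U) (a b c d : Fin 4) :
    weylUp Gt a b c d y = (Real.exp (2 * f y) ^ 2)⁻¹ * weylUp G a b c d y := by
  have hne := (Real.exp_pos (2 * f y)).ne'
  simp only [weylUp, Finset.mul_sum]
  refine Finset.sum_congr rfl fun i _ ↦ Finset.sum_congr rfl fun j _ ↦
    Finset.sum_congr rfl fun k _ ↦ ?_
  rw [h.inv_eq hy, h.inv_eq hy, h.inv_eq hy, h.weylLow_eq hy]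
  field_simp

lemma weylSq_eq (h : IsConformalOn G Gt f U) (hy : y ∈ U) :
    weylSq Gt y = (Real.exp (2 * f y) ^ 2)⁻¹ * weylSq G y := by
  have hne := (Real.exp_pos (2 * f y)).ne'
  simp only [weylSq, Finset.mul_sum]
  refine Finset.sum_congr rfl fun a _ ↦ Finset.sum_congr rfl fun b _ ↦
    Finset.sum_congr rfl fun c _ ↦ Finset.sum_congr rfl fun d _ ↦ Finset.sum_congr rfl fun e _ ↦ ?_
  rw [h.inv_eq hy, h.weylLow_eq hy, h.weylUp_eq hy]
  field_simp

/-- The conformal change of the covector `Λ_d`. -/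
lemma Lam_eq (h : IsConformalOn G Gt f U) (hy : y ∈ U) (hC : weylSq G y ≠ 0) (d : Fin 4) :
    Lam Gt d y = Lam G d y + pd d f y := by
  have hne := (Real.exp_pos (2 * f y)).ne'
  have e1 : ∑ a, ∑ m, ∑ p, weylUp G d a m p y * ∑ e, weyl G m p a e y * pd e f y =
      -(1 / 4) * weylSq G y * pd d f y := by
    have e2 := sum_sum_sum_reverse (fun (a : Fin 4) (q : Fin 4 × Fin 4) (e : Fin 4) ↦
      weylUp G d a q.1 q.2 y * (weyl G q.1 q.2 a e y * pd e f y))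
    simp only [Fintype.sum_prod_type] at e2
    have e3 : ∑ e, delta d e * (-(1 / 4) * weylSq G y * pd e f y) =
        -(1 / 4) * weylSq G y * pd d f y := sum_delta_mul _ _
    simp only [Finset.mul_sum]
    rw [e2, ← e3]
    refine Finset.sum_congr rfl fun e _ ↦ ?_
    -- The trivial third index makes this a plain exchange of a with the pair (m, p), undoing the
    -- order left by `e2`.
    have e4 := sum_sum_sum_reverse (fun (a : Fin 4) (q : Fin 4 × Fin 4) (_ : Unit) ↦
      weylUp G d a q.1 q.2 y * weyl G q.1 q.2 a e y)
    simp only [Fintype.sum_prod_type, Finset.univ_unique, Finset.sum_singleton,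
      h.left.sum_weylUp_mul_weyl hy] at e4
    simp only [← mul_assoc, ← Finset.sum_mul]
    rw [← e4]
    ring
  have e5 : ∑ a, ∑ m, ∑ p, weylUp Gt d a m p y *
        ((1 / 2) * (covSchouten Gt m p a y - covSchouten Gt p m a y)) =
      (Real.exp (2 * f y) ^ 2)⁻¹ * (∑ a, ∑ m, ∑ p, weylUp G d a m p y *
        ((1 / 2) * (covSchouten G m p a y - covSchouten G p m a y))
      - (1 / 2) * ∑ a, ∑ m, ∑ p, weylUp G d a m p y * ∑ e, weyl G m p a e y * pd e f y) := by
    rw [mul_sub]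
    simp only [h.cotton_eq hy, h.weylUp_eq hy]
    generalize hs : (fun m p a ↦ ∑ e, weyl G m p a e y * pd e f y) = s
    have hs' (m p a : Fin 4) : ∑ e, weyl G m p a e y * pd e f y = s m p a := by rw [← hs]
    simp only [hs', Finset.mul_sum, ← Finset.sum_sub_distrib]
    refine Finset.sum_congr rfl fun a _ ↦ Finset.sum_congr rfl fun m _ ↦
      Finset.sum_congr rfl fun p _ ↦ ?_
    ring
  -- The coefficient of ∂_d f is 8 · (-1/2) · (-1/4) = 1; this is what fixes the 8 in Λ.
  rw [Lam, Lam, e5, e1, h.weylSq_eq hy]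
  field_simp
  ring

/-- Conformal covariance of the operator `D^s_a`, in coordinates. -/
lemma conformalDiff_eq (h : IsConformalOn G Gt f U) (hy : y ∈ U) (hC : weylSq G y ≠ 0) (s : ℤ)
    {w wt : E4 → ℝ} (hw : DifferentiableAt ℝ w y)
    (hwt : ∀ z ∈ U, wt z = Real.exp (-f z) ^ s * w z) (a : Fin 4) :
    conformalDiff Gt s wt a y = Real.exp (-f y) ^ s * conformalDiff G s w a y := by
  -- As an exponential of -s f, the integer power can be differentiated uniformly in the sign of s.
  have hexp (z : E4) : Real.exp (-f z) ^ s = Real.exp (-(s : ℝ) * f z) := by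
    rw [← Real.rpow_intCast, ← Real.exp_mul]; congr 1; ring
  simp only [hexp] at hwt ⊢
  have hf := differentiableAt_of_contDiffOn h.left.isOpen h.smooth hy
  rw [conformalDiff, conformalDiff, h.Lam_eq hy hC, pd_congr h.left.isOpen hy hwt,
    pd_mul (hf.const_mul _).exp hw, pd_exp (hf.const_mul _), pd_const_mul hf, hwt y hy]
  ring

end IsConformalOn

end Coord

/-! ### From the manifold to coordinates. -/

/-- The vector field that a chart represents by a constant vector is smooth. -/
lemma contMDiffOn_chartVector {E : Type*} [NormedAddCommGroup E] [NormedSpace ℝ E]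
    {M : Type*} [TopologicalSpace M] [ChartedSpace E M] [IsManifold 𝓘(ℝ, E) ∞ M]
    {φ : OpenPartialHomeomorph M E} (hφ : φ ∈ IsManifold.maximalAtlas 𝓘(ℝ, E) ∞ M) (v : E) :
    ContMDiffOn 𝓘(ℝ, E) 𝓘(ℝ, E).tangent ∞
      (fun y ↦ Bundle.TotalSpace.mk' E (E := TangentSpace 𝓘(ℝ, E)) (φ.symm y)
        (chartVector φ y v)) φ.target := by
  have h1 := (contMDiffOn_symm_of_mem_maximalAtlas hφ).contMDiffOn_tangentMapWithin (m := ∞)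
    (by simp) φ.open_target.uniqueMDiffOn
  have h2 : ContMDiff 𝓘(ℝ, E) 𝓘(ℝ, E).tangent ∞
      (fun y : E ↦ Bundle.TotalSpace.mk' E (E := TangentSpace 𝓘(ℝ, E)) y v) :=
    contMDiff_vectorSpace_iff_contDiff.2 contDiff_const
  refine (h1.comp h2.contMDiffOn fun y hy ↦ hy).congr fun y hy ↦ ?_
  simp only [Function.comp, tangentMapWithin, chartVector]
  rw [mfderivWithin_of_isOpen φ.open_target hy]

lemma contDiffOn_comp_symm {M : Type*} [TopologicalSpace M] [ChartedSpace E4 M]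
    {φ : OpenPartialHomeomorph M E4} (hφ : φ ∈ IsManifold.maximalAtlas (𝓡 4) ∞ M)
    (w : C^∞⟮𝓡 4, M; ℝ⟯) : ContDiffOn ℝ ∞ (w ∘ φ.symm) φ.target :=
  contMDiffOn_iff_contDiffOn.1
    (w.contMDiff.comp_contMDiffOn (contMDiffOn_symm_of_mem_maximalAtlas hφ))

namespace PseudoRiemannianMetric

variable {M : Type*} [TopologicalSpace M] [ChartedSpace E4 M] [IsManifold (𝓡 4) ∞ M]
  {φ : OpenPartialHomeomorph M E4}

lemma contMDiffOn_coordVector (hφ : φ ∈ IsManifold.maximalAtlas (𝓡 4) ∞ M) (i : Fin 4) :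
    ContMDiffOn (𝓡 4) (𝓡 4).tangent ∞
      (fun y ↦ Bundle.TotalSpace.mk' E4 (E := TangentSpace (𝓡 4)) (φ.symm y) (coordVector φ i y))
      φ.target :=
  contMDiffOn_chartVector hφ _

lemma contDiffOn_components (g : PseudoRiemannianMetric M)
    (hφ : φ ∈ IsManifold.maximalAtlas (𝓡 4) ∞ M) (i j : Fin 4) :
    ContDiffOn ℝ ∞ (g.components φ i j) φ.target := by
  have hs := contMDiffOn_symm_of_mem_maximalAtlas hφ
  have h1 : ContMDiffOn (𝓡 4) ((𝓡 4).prod 𝓘(ℝ, E4 →L[ℝ] E4 →L[ℝ] ℝ)) ∞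
      (fun y ↦ Bundle.TotalSpace.mk' (E4 →L[ℝ] E4 →L[ℝ] ℝ)
        (E := fun x : M ↦ TangentSpace (𝓡 4) x →L[ℝ] TangentSpace (𝓡 4) x →L[ℝ] ℝ)
        (φ.symm y) (g.inner (φ.symm y))) φ.target :=
    g.contMDiff.comp_contMDiffOn hs
  have h2 : ContMDiffOn (𝓡 4) ((𝓡 4).prod 𝓘(ℝ, ℝ)) ∞
      (fun y ↦ Bundle.TotalSpace.mk' ℝ (E := Bundle.Trivial M ℝ) (φ.symm y)
        (g.inner (φ.symm y) (coordVector φ i y) (coordVector φ j y))) φ.target :=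
    ContMDiffOn.clm_bundle_apply₂ (E₁ := TangentSpace (𝓡 4)) (E₂ := TangentSpace (𝓡 4))
      (F₁ := E4) (F₂ := E4) h1 (contMDiffOn_coordVector hφ i) (contMDiffOn_coordVector hφ j)
  rw [← contMDiffOn_iff_contDiffOn]
  intro y hy
  have h3 := h2 y hy
  simp only [Bundle.contMDiffWithinAt_totalSpace] at h3
  exact h3.2

/-- A kernel vector of the matrix is carried by the derivative of φ⁻¹ to a vector orthogonal to the
image of that derivative, which is the whole tangent space. Nondegeneracy makes it zero, and
injectivity of the derivative kills the kernel vector. -/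
lemma det_components_ne_zero (g : PseudoRiemannianMetric M)
    (hφ : φ ∈ IsManifold.maximalAtlas (𝓡 4) ∞ M) {y : E4} (hy : y ∈ φ.target) :
    (Matrix.of fun i j ↦ g.components φ i j y).det ≠ 0 := by
  intro h0
  obtain ⟨v, hv, hGv⟩ := Matrix.exists_mulVec_eq_zero_iff.2 h0
  have hd : φ.MDifferentiable (𝓡 4) (𝓡 4) :=
    ⟨(contMDiffOn_of_mem_maximalAtlas hφ).mdifferentiableOn (by simp),
      (contMDiffOn_symm_of_mem_maximalAtlas hφ).mdifferentiableOn (by simp)⟩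
  obtain ⟨A, hA⟩ : ∃ A : E4 →L[ℝ] TangentSpace (𝓡 4) (φ.symm y),
    A = mfderiv (𝓡 4) (𝓡 4) φ.symm y := ⟨_, rfl⟩
  obtain ⟨hinj, hsurj⟩ : Function.Injective A ∧ Function.Surjective A := by
    rw [hA]; exact hd.symm.mfderiv_bijective hy
  have hsum (u : E4) : A u = ∑ i, u i • coordVector φ i y := by
    conv_lhs => rw [← (EuclideanSpace.basisFun (Fin 4) ℝ).sum_repr u]
    rw [map_sum]
    refine Finset.sum_congr rfl fun i _ ↦ ?_
    rw [map_smul]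
    simp [coordVector, chartVector, hA]
    rfl
  have hzero : A (WithLp.toLp 2 v) = 0 := by
    refine g.nondegenerate _ _ fun w ↦ ?_
    obtain ⟨u, rfl⟩ := hsurj w
    rw [g.symm, hsum u, map_sum, sum_apply]
    refine Finset.sum_eq_zero fun i _ ↦ ?_
    rw [map_smul, smul_apply, hsum, map_sum]
    have := congrFun hGv i
    simp only [Matrix.mulVec, dotProduct, Matrix.of_apply, components, Pi.zero_apply] at this
    refine smul_eq_zero_of_right _ (Eq.trans ?_ this)
    refine Finset.sum_congr rfl fun j _ ↦ ?_
    rw [map_smul, smul_eq_mul, mul_comm]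
  have : WithLp.toLp 2 v = (0 : E4) := hinj (by rw [map_zero]; exact hzero)
  exact hv (by simpa using this)

lemma isMetricOn_components (g : PseudoRiemannianMetric M)
    (hφ : φ ∈ IsManifold.maximalAtlas (𝓡 4) ∞ M) :
    Coord.IsMetricOn (g.components φ) φ.target where
  isOpen := φ.open_target
  smooth := g.contDiffOn_components hφ
  symm _ _ _ := g.symm _ _ _
  det_ne_zero _ := g.det_components_ne_zero hφ

lemma ConformallyRelated.isConformalOn {g gt : PseudoRiemannianMetric M} {Θ : C^∞⟮𝓡 4, M; ℝ⟯}
    (h : g.ConformallyRelated gt Θ) (hφ : φ ∈ IsManifold.maximalAtlas (𝓡 4) ∞ M) :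
    Coord.IsConformalOn (g.components φ) (gt.components φ)
      (fun y ↦ -Real.log (Θ (φ.symm y))) φ.target where
  left := g.isMetricOn_components hφ
  right := gt.isMetricOn_components hφ
  -- Positivity of Θ is what makes its logarithm smooth.
  smooth := ((contDiffOn_comp_symm hφ Θ).log fun y _ ↦ (h.1 (φ.symm y)).ne').neg
  eq i j y _ := by
    have hpos := h.1 (φ.symm y)
    have : Real.exp (2 * -Real.log (Θ (φ.symm y))) = (Θ (φ.symm y) ^ 2)⁻¹ := by
      rw [mul_neg, Real.exp_neg, two_mul, Real.exp_add, Real.exp_log hpos, sq]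
    rw [this, components, components, h.2]
    field_simp

end PseudoRiemannianMetric

theorem mainTheorem5 {M : Type*} [TopologicalSpace M] [ChartedSpace E4 M]
    [IsManifold (𝓡 4) ∞ M]
    (g gt : PseudoRiemannianMetric M) (Θ : C^∞⟮𝓡 4, M; ℝ⟯)
    (hconf : g.ConformallyRelated gt Θ) (hC : g.WeylNondegenerate)
    (s : ℤ) (w wt : C^∞⟮𝓡 4, M; ℝ⟯) (hw : ∀ x, wt x = Θ x ^ s * w x) :
    ∀ φ ∈ IsManifold.maximalAtlas (𝓡 4) ∞ M, ∀ x ∈ φ.source, ∀ a : Fin 4,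
      gt.conformalDiff s wt φ a x = Θ x ^ s * g.conformalDiff s w φ a x := by
  intro φ hφ x hx a
  have hy := φ.map_source hx
  have hexp (z : E4) : Real.exp (- -Real.log (Θ (φ.symm z))) = Θ (φ.symm z) := by
    rw [neg_neg, Real.exp_log (hconf.1 _)]
  have key := (hconf.isConformalOn hφ).conformalDiff_eq hy (hC φ hφ x hx) s
    (Coord.differentiableAt_of_contDiffOn φ.open_target
      (contDiffOn_comp_symm hφ w) hy)
    (wt := wt ∘ φ.symm) (fun z _ ↦ by rw [hexp]; exact hw _) a
  rwa [hexp, φ.left_inv hx] at key
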